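/- **Setting.** Let $\Omega$ be the experimental region (any set). A design $\xi$ assigns weights $\lambda_i>0$, $\sum_i\lambda_i=1$, to finitely many support points $x_i\in\Omega$. Let $\mathcal M'=\{M_1,\dots,M_m\}$ be a finite set of generalized linear models $M_j=(h_j,\boldsymbol g_j,\boldsymbol\beta_j)$ on $\Omega$, with link function $h_j$, basis functions $\boldsymbol g_j$ and coefficient vector $\boldsymbol\beta_j$: the response $Y(x)$ follows a distribution in a (non-degenerate) exponential family with mean $\mu_j(x)=h_j^{-1}(\boldsymbol\beta_j^\top\boldsymbol g_j(x))$, where $h_j$ is injective and differentiable with non-zero derivative on the set of possible means. The Fisher information matrix is $$\mathsf I_j(\xi)=\sum_i\lambda_i\,w_j(x_i)\,\boldsymbol g_j(x_i)\boldsymbol g_j(x_i)^\top,\qquad w_j(x)=\big[\operatorname{Var}(Y(x))\,h_j'(\mu_j(x))^2\big]^{-1}.$$ Let $\boldsymbol f_j$ be a vector of $q_j$ functions of the coefficients, differentiable at $\boldsymbol\beta_j$ with Jacobian matrix $\mathsf B_j$ there, and put $\mathsf F_j(\xi)=\mathsf B_j\mathsf I_j(\xi)^{-1}\mathsf B_j^\top$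 when $\mathsf I_j(\xi)$ is invertible. For $0<p<\infty$ let $\Phi_p^j(\xi)=\big(q_j^{-1}\operatorname{tr}[\mathsf F_j(\xi)^p]\big)^{1/p}$; for $p=0$ (D-optimality) let $\Phi_0^j(\xi)$ be either the limit $(\det\mathsf F_j(\xi))^{1/q_j}$ or the logarithmic form $\log\det\mathsf F_j(\xi)$ (the same form for all $j$). Only designs with invertible information matrices compete in the minimizations below. Let $\xi^{\mathrm{opt}}_j$ be a local optimal design, that is, a minimizer of $\Phi_p^j$, and assume that $\Phi_p^{\mathrm{opt}_j}=\Phi_p^j(\xi^{\mathrm{opt}}_j)>0$, so that the efficiencies $\Phi_p^{\mathrm{opt}_j}/\Phi_p^j(\xi)$ are well defined and lie in $(0,1]$. Put $$\mathrm{se}(\xi,\mathcal M')=\sum_{j=1}^m\exp\!\Big(\frac{\Phi_p^j(\xi)}{\Phi_p^{\mathrm{opt}_j}}\Big),\qquad \mathrm{lse}(\xi,\mathcal M')=\ln \mathrm{se}(\xi,\mathcal M'),$$ and let $\phi(x,\xi)=\lim_{\alpha\to0^+}\alpha^{-1}\big[\mathrm{se}((1-\alpha)\xi+\alpha\delta_x,\mathcal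 M')-\mathrm{se}(\xi,\mathcal M')\big]$, where $\delta_x$ is the one-point design at $x$. An Mm-$\Phi_p$ design $\xi^{\mathrm{mr}}$ is a minimizer of $\mathrm{lse}(\cdot,\mathcal M')$. **Algorithm.** Let $\mathcal C\subset\Omega$ be a finite candidate pool. Start from a finite set $\mathcal X^{(0)}\subset\Omega$ of design points and let $\xi^{(0)}$ minimize $\mathrm{se}(\cdot,\mathcal M')$ over the designs supported in $\mathcal X^{(0)}$. For $r=1,2,\dots$ choose any $x_r^*\in\arg\min_{x\in\mathcal C}\phi(x,\xi^{(r-1)})$, put $\mathcal X^{(r)}=\mathcal X^{(r-1)}\cup\{x_r^*\}$ and let $\xi^{(r)}$ minimize $\mathrm{se}(\cdot,\mathcal M')$ over the designs supported in $\mathcal X^{(r)}$ (optimal weights). The algorithm is run without a stopping rule. **Theorem 3 (Convergence of the Mm-$\Phi_p$ algorithm).** Assume that the candidate pool $\mathcal C$ contains all the support points of an Mm-$\Phi_p$ design $\xi^{\mathrm{mr}}$. Then every sequence of designs $\xi^{(r)}$ constructed by the algorithm satisfies $$\lim_{r\to\infty}\mathrm{lse}(\xi^{(r)},\mathcal M')=\mathrm{lse}(\xi^{\mathrm{mr}},\mathcal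 M').$$ -/

import Mathlib

open MeasureTheory ProbabilityTheory Filter Topology

/-- A (natural, one-parameter) exponential family of response distributions on the real line,
given by its base measure; the members have densities proportional to `exp (θ y)` with respect
to it. A known dispersion parameter is absorbed into the base measure. The base measure is not
concentrated at a single point, so that no member of the family is degenerate. -/
structure ExpFamily where
  base : Measure ℝ
  nondegenerate : ∀ c : ℝ, base {c}ᶜ ≠ 0

namespace ExpFamily

/-- The interior of the natural parameter space. -/
def params (E : ExpFamily) : Set ℝ :=
  interior (integrableExpSet id E.base)

/-- The member with natural parameter `θ`: density `exp (θ y) / ∫ exp (θ z) d base(z)`. -/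
noncomputable def law (E : ExpFamily) (θ : ℝ) : Measure ℝ :=
  E.base.tilted (fun y => θ * y)

/-- The mean of the member with natural parameter `θ`. -/
noncomputable def mean (E : ExpFamily) (θ : ℝ) : ℝ :=
  ∫ y, y ∂(E.law θ)

/-- The set of possible mean responses. -/
def meanSpace (E : ExpFamily) : Set ℝ :=
  E.mean '' E.params

/-- The variance of the member of the family whose mean is `μ` (for `μ ∈ meanSpace`; the mean
determines the natural parameter because the family is not degenerate). -/
noncomputable def varOfMean (E : ExpFamily) (μ : ℝ) : ℝ :=
  variance id (E.law (Function.invFunOn E.mean E.params μ))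

end ExpFamily

/-- A model specification `M = (h, g, β)` of a generalized linear model on the experimental
region `Ω` with responses in the exponential family `E`, together with the vector `f` of
functions of the regression coefficients that is of interest. -/
structure ModelSpec (E : ExpFamily) (Ω : Type*) where
  /-- number of regression coefficients -/
  l : ℕ
  /-- number of functions of interest -/
  q : ℕ
  /-- link function -/
  h : ℝ → ℝ
  /-- basis functions -/
  g : Ω → Fin l → ℝ
  /-- regression coefficients -/
  β : Fin l → ℝ
  /-- functions of the coefficients -/
  f : (Fin l → ℝ) → Fin q → ℝ
  h_injOn : Set.InjOn h E.meanSpace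
  h_diff : ∀ μ ∈ E.meanSpace, DifferentiableAt ℝ h μ
  h_deriv_ne_zero : ∀ μ ∈ E.meanSpace, deriv h μ ≠ 0
  /-- every linear predictor is the link of a possible mean response -/
  predictor_mem : ∀ x, β ⬝ᵥ g x ∈ h '' E.meanSpace
  f_diff : DifferentiableAt ℝ f β

namespace ModelSpec

variable {E : ExpFamily} {Ω : Type*}

/-- The mean response `μ(x) = h⁻¹ (βᵀ g(x))`. -/
noncomputable def mu (M : ModelSpec E Ω) (x : Ω) : ℝ :=
  Function.invFunOn M.h E.meanSpace (M.β ⬝ᵥ M.g x)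

/-- The weight `w(x, M) = [Var(Y(x)) h'(μ(x))²]⁻¹`. -/
noncomputable def w (M : ModelSpec E Ω) (x : Ω) : ℝ :=
  (E.varOfMean (M.mu x) * (deriv M.h (M.mu x)) ^ 2)⁻¹

/-- The Fisher information matrix `I(ξ, M) = ∑ᵢ λᵢ w(xᵢ, M) g(xᵢ) g(xᵢ)ᵀ` of the finitely
supported weighting `ξ`. -/
noncomputable def info (M : ModelSpec E Ω) (ξ : Ω →₀ ℝ) : Matrix (Fin M.l) (Fin M.l) ℝ :=
  ξ.sum fun x lam => (lam * M.w x) • Matrix.vecMulVec (M.g x) (M.g x)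

/-- The Jacobian matrix `B = ∂f/∂βᵀ` at the coefficients of the model. -/
noncomputable def jac (M : ModelSpec E Ω) : Matrix (Fin M.q) (Fin M.l) ℝ :=
  LinearMap.toMatrix' (fderiv ℝ M.f M.β).toLinearMap

/-- `F(ξ) = B I(ξ, M)⁻¹ Bᵀ`. -/
noncomputable def F (M : ModelSpec E Ω) (ξ : Ω →₀ ℝ) : Matrix (Fin M.q) (Fin M.q) ℝ :=
  M.jac * (M.info ξ)⁻¹ * M.jac.transpose

end ModelSpec

/-- The optimality criteria: `Φ_p` with `0 < p < ∞`, its limit `Φ_0` as `p → 0`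
(D-optimality), and the logarithmic form of D-optimality. -/
inductive OptCriterion where
  | phi (p : ℝ) (hp : 0 < p)
  | phiZero
  | logDet

section Design

variable {E : ExpFamily} {Ω : Type*} {ι : Type*} [Fintype ι]

/-- An (approximate) design: finitely many support points with positive weights summing to one.
The support points are the elements of `ξ.support`. -/
def IsDesign (ξ : Ω →₀ ℝ) : Prop :=
  (∀ x, 0 ≤ ξ x) ∧ (ξ.sum fun _ lam => lam) = 1

/-- The value of the criterion at `ξ` for the model `M`; it is meaningful where the information
matrix is invertible. Matrix powers are taken by functional calculus. -/
noncomputable def Phi (c : OptCriterion) (M : ModelSpec E Ω) (ξ : Ω →₀ ℝ) : ℝ :=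
  match c with
  | .phi p _ => ((M.q : ℝ)⁻¹ * (cfc (fun t : ℝ => t ^ p) (M.F ξ)).trace) ^ (1 / p)
  | .phiZero => (M.F ξ).det ^ (1 / (M.q : ℝ))
  | .logDet => Real.log (M.F ξ).det

/-- `ξ` is a design with invertible information matrix for `M`. -/
def IsRegularDesign (M : ModelSpec E Ω) (ξ : Ω →₀ ℝ) : Prop :=
  IsDesign ξ ∧ IsUnit (M.info ξ).det

/-- `ξ` is a local optimal design for `M`. -/
def IsLocalOptimal (c : OptCriterion) (M : ModelSpec E Ω) (ξ : Ω →₀ ℝ) : Prop :=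
  IsRegularDesign M ξ ∧ ∀ ξ', IsRegularDesign M ξ' → Phi c M ξ ≤ Phi c M ξ'

/-- The efficiency `Φ(ξ', M) / Φ(ξ, M)` of `ξ` relative to `ξ'`. -/
noncomputable def eff (c : OptCriterion) (M : ModelSpec E Ω) (ξ ξ' : Ω →₀ ℝ) : ℝ :=
  Phi c M ξ' / Phi c M ξ

/-- `∑ⱼ exp (1 / eff(ξ, ξoptⱼ; Mⱼ))`. -/
noncomputable def se (c : OptCriterion) (M : ι → ModelSpec E Ω) (ξopt : ι → Ω →₀ ℝ)
    (ξ : Ω →₀ ℝ) : ℝ :=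
  ∑ j, Real.exp (1 / eff c (M j) ξ (ξopt j))

/-- The log-sum-exp criterion. -/
noncomputable def lse (c : OptCriterion) (M : ι → ModelSpec E Ω) (ξopt : ι → Ω →₀ ℝ)
    (ξ : Ω →₀ ℝ) : ℝ :=
  Real.log (se c M ξopt ξ)

/-- The directional derivative `φ(ξ', ξ)` of `se` at `ξ` in the direction of `ξ'`: the right
derivative at `α = 0` of `se ((1 - α) ξ + α ξ')`. -/
noncomputable def dirDeriv (c : OptCriterion) (M : ι → ModelSpec E Ω) (ξopt : ι → Ω →₀ ℝ)
    (ξ' ξ : Ω →₀ ℝ) : ℝ :=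
  derivWithin (fun α : ℝ => se c M ξopt ((1 - α) • ξ + α • ξ')) (Set.Ici 0) 0

/-- The directional derivative `φ(x, ξ)` in the direction of the one-point design at `x`. -/
noncomputable def dirDerivAt (c : OptCriterion) (M : ι → ModelSpec E Ω) (ξopt : ι → Ω →₀ ℝ)
    (x : Ω) (ξ : Ω →₀ ℝ) : ℝ :=
  dirDeriv c M ξopt (Finsupp.single x 1) ξ

/-- `ξ` is a design whose information matrices under all models are invertible. -/
def IsRegularForAll (M : ι → ModelSpec E Ω) (ξ : Ω →₀ ℝ) : Prop :=
  IsDesign ξ ∧ ∀ j, IsUnit ((M j).info ξ).det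

/-- `ξ` minimizes the log-sum-exp criterion over all designs whose information matrices under
all models are invertible. -/
def IsMmDesign (c : OptCriterion) (M : ι → ModelSpec E Ω) (ξopt : ι → Ω →₀ ℝ)
    (ξ : Ω →₀ ℝ) : Prop :=
  IsRegularForAll M ξ ∧ ∀ ξ', IsRegularForAll M ξ' → lse c M ξopt ξ ≤ lse c M ξopt ξ'

/-- `ξ` carries optimal weights on the set of design points `S`: it minimizes `se` over the
designs with all support points in `S` (weights may vanish) and invertible information
matrices. -/
def HasOptimalWeights (c : OptCriterion) (M : ι → ModelSpec E Ω) (ξopt : ι → Ω →₀ ℝ)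
    (S : Finset Ω) (ξ : Ω →₀ ℝ) : Prop :=
  ξ.support ⊆ S ∧ IsRegularForAll M ξ ∧
    ∀ ξ', ξ'.support ⊆ S → IsRegularForAll M ξ' → se c M ξopt ξ ≤ se c M ξopt ξ'

/-- `X r` and `ξ r` are the point sets and designs of a run, without stopping rule, of the
sequential algorithm with candidate pool `C`: start with optimal weights on `X 0`; then
repeatedly add a candidate that minimizes `φ(·, ξ r)` over the pool (ties are broken
arbitrarily) and reoptimize the weights. -/
def IsSequentialRun (c : OptCriterion) (M : ι → ModelSpec E Ω) (ξopt : ι → Ω →₀ ℝ)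
    (C : Finset Ω) (X : ℕ → Finset Ω) (ξ : ℕ → Ω →₀ ℝ) : Prop :=
  HasOptimalWeights c M ξopt (X 0) (ξ 0) ∧
    ∀ r, (∃ x ∈ C, (∀ y ∈ C, dirDerivAt c M ξopt x (ξ r) ≤ dirDerivAt c M ξopt y (ξ r)) ∧
        (X (r + 1) : Set Ω) = insert x (X r : Set Ω)) ∧
      HasOptimalWeights c M ξopt (X (r + 1)) (ξ (r + 1))

end Design

/-! The run reaches the optimum after finitely many steps. The point sets increase inside the finite
set `X 0 ∪ C`, so they stabilize; from then on the selected candidate `x` already lies in `X r`.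
Optimality of the weights on `X r` makes the derivative towards `x` non-negative
(`HasOptimalWeights.dirDerivAt_nonneg`), and `x` minimizes over `C`, so all derivatives over `C` are
non-negative. Convexity of `se` then rules out any better design on `C`
(`se_le_of_dirDerivAt_nonneg`).

The work lies in `exists_se_tangent`: directional derivatives of `se` are linear in the direction
and give a global lower bound. As the information matrix is linear in the design, this reduces to
`HasTangent` for the criteria as functions of `N`, where `F = B N⁻¹ Bᵀ` may be singular. Spectral
sums of `F` and `F₀` are compared through the squared overlaps of their eigenbases: a tangent of `f`
in `t⁻¹` gives a lower bound linear in `N` (`le_spectral_sum`), a quadratic majorant of `f` gives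
the matching upper bound (`spectral_sum_le`), and squeezing yields the derivative. No
differentiability of eigenvalues or eigenvectors is needed. -/

set_option linter.unusedSectionVars false

/-! ### Eigenbases and their overlaps -/

namespace Matrix

variable {m n : Type*} [Fintype m] [DecidableEq m] [Fintype n] [DecidableEq n]

/-- The vectors `u i` form an orthonormal basis of eigenvectors of `A` with eigenvalues `d i`. -/
structure IsEigenbasis (A : Matrix m m ℝ) (d : m → ℝ) (u : m → m → ℝ) : Prop where
  mulVec_eq : ∀ i, A *ᵥ u i = d i • u i
  parseval : ∀ x y : m → ℝ, ∑ i, (x ⬝ᵥ u i) * (y ⬝ᵥ u i) = x ⬝ᵥ y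
  orthonormal : ∀ i j, u i ⬝ᵥ u j = if i = j then 1 else 0

theorem IsHermitian.exists_isEigenbasis {A : Matrix m m ℝ} (hA : A.IsHermitian) :
    ∃ (d : m → ℝ) (u : m → m → ℝ), A.IsEigenbasis d u ∧
      A.det = ∏ i, d i ∧ A.trace = ∑ i, d i ∧
      ∀ f : ℝ → ℝ, (_root_.cfc f A).trace = ∑ i, f (d i) := by
  have key : ∀ x y : EuclideanSpace ℝ m, inner ℝ x y = y.ofLp ⬝ᵥ x.ofLp := fun x y => by
    simp [EuclideanSpace.inner_eq_star_dotProduct]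
  refine ⟨hA.eigenvalues, fun i => (hA.eigenvectorBasis i).ofLp, ⟨?_, ?_, ?_⟩, ?_, ?_, ?_⟩
  · intro i
    exact hA.mulVec_eigenvectorBasis i
  · intro x y
    have h := hA.eigenvectorBasis.sum_inner_mul_inner (WithLp.toLp 2 x) (WithLp.toLp 2 y)
    simp only [key] at h
    rw [dotProduct_comm x y, ← h]
    refine Finset.sum_congr rfl fun i _ => ?_
    rw [dotProduct_comm x]
  · intro i j
    rw [← key, orthonormal_iff_ite.1 hA.eigenvectorBasis.orthonormal j i]
    simp only [eq_comm]
  · simpa using hA.det_eq_prod_eigenvalues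
  · simpa using hA.trace_eq_sum_eigenvalues
  · intro f
    rw [hA.cfc_eq f, IsHermitian.cfc, Unitary.conjStarAlgAut_apply, trace_mul_cycle]
    simp

namespace IsEigenbasis

variable {A A₀ : Matrix m m ℝ} {d μ : m → ℝ} {u v : m → m → ℝ}

theorem norm_one (h : A.IsEigenbasis d u) (i : m) : u i ⬝ᵥ u i = 1 := by
  simp [h.orthonormal]

theorem sum_sq (h : A.IsEigenbasis d u) (x : m → ℝ) : ∑ i, (x ⬝ᵥ u i) ^ 2 = x ⬝ᵥ x := by
  simpa [sq] using h.parseval x x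

theorem dotProduct_mulVec_eq (h : A.IsEigenbasis d u) (i : m) : u i ⬝ᵥ A *ᵥ u i = d i := by
  rw [h.mulVec_eq, dotProduct_smul, h.norm_one, smul_eq_mul, mul_one]

theorem mulVec_dotProduct (h : A.IsEigenbasis d u) (hA : A.IsHermitian) (x : m → ℝ) (i : m) :
    (A *ᵥ x) ⬝ᵥ u i = d i * (x ⬝ᵥ u i) := by
  have hT : A.transpose = A := by simpa using hA.eq
  rw [dotProduct_comm, dotProduct_mulVec, ← mulVec_transpose, hT, h.mulVec_eq, smul_dotProduct,
    dotProduct_comm (u i), smul_eq_mul]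

theorem nonneg (h : A.IsEigenbasis d u) (hA : A.PosSemidef) (i : m) : 0 ≤ d i := by
  have := hA.dotProduct_mulVec_nonneg (u i)
  rw [star_trivial, h.dotProduct_mulVec_eq] at this
  exact this

/-- A spectral sum of `A` as a double sum over the overlaps of two eigenbases. -/
theorem sum_eq_sum_overlap (h₀ : A₀.IsEigenbasis d u) (h : A.IsEigenbasis μ v) (f : ℝ → ℝ) :
    ∑ a, f (μ a) = ∑ i, ∑ a, (u i ⬝ᵥ v a) ^ 2 * f (μ a) := by
  rw [Finset.sum_comm]
  refine Finset.sum_congr rfl fun a _ => ?_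
  have := h₀.sum_sq (v a)
  rw [h.norm_one] at this
  simp_rw [dotProduct_comm (u _) (v a)]
  rw [← Finset.sum_mul, this, one_mul]

theorem sum_overlap_mul (h : A.IsEigenbasis μ v) (hA : A.IsHermitian) (x : m → ℝ) :
    ∑ a, (x ⬝ᵥ v a) ^ 2 * μ a = x ⬝ᵥ A *ᵥ x := by
  rw [← h.parseval x (A *ᵥ x)]
  refine Finset.sum_congr rfl fun a _ => ?_
  rw [h.mulVec_dotProduct hA]; ring

/-- Parseval, since `(A - A₀) *ᵥ u i` has coordinate `(μ a - d i) * (u i ⬝ᵥ v a)` along `v a`. This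
makes the quadratic error second order in the perturbation. -/
theorem sum_overlap_sq (h₀ : A₀.IsEigenbasis d u) (h : A.IsEigenbasis μ v) (hA : A.IsHermitian)
    (i : m) : ∑ a, (u i ⬝ᵥ v a) ^ 2 * (μ a - d i) ^ 2 =
      ((A - A₀) *ᵥ u i) ⬝ᵥ ((A - A₀) *ᵥ u i) := by
  rw [← h.sum_sq]
  refine Finset.sum_congr rfl fun a _ => ?_
  rw [sub_mulVec, sub_dotProduct, h.mulVec_dotProduct hA, h₀.mulVec_eq, smul_dotProduct,
    smul_eq_mul]; ring

end IsEigenbasis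

/-! ### The matrices `B N⁻¹ Bᵀ` -/

section Compress

variable {B : Matrix m n ℝ} {N N₀ : Matrix n n ℝ}

theorem PosDef.transpose_eq (hN : N.PosDef) : N.transpose = N := by
  simpa using hN.isHermitian.eq

theorem PosDef.mulVec_inv_mulVec (hN : N.PosDef) (x : n → ℝ) : N *ᵥ (N⁻¹ *ᵥ x) = x := by
  rw [mulVec_mulVec, mul_nonsing_inv _ ((isUnit_iff_isUnit_det N).1 hN.isUnit), one_mulVec]

theorem posSemidef_compress (hN : N.PosDef) : (B * N⁻¹ * B.transpose).PosSemidef := by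
  simpa using hN.inv.posSemidef.mul_mul_conjTranspose_same B

theorem dotProduct_compress (x y : m → ℝ) :
    x ⬝ᵥ (B * N⁻¹ * B.transpose) *ᵥ y =
      (B.transpose *ᵥ x) ⬝ᵥ N⁻¹ *ᵥ (B.transpose *ᵥ y) := by
  rw [← mulVec_mulVec, ← mulVec_mulVec, dotProduct_mulVec, ← mulVec_transpose]

/-- The quadratic form at `x` is that of the positive definite `N⁻¹` at `Bᵀ x`. Together with
`compress_mulVec_eq_zero`, the kernel is that of `Bᵀ`, whatever the positive definite `N`. -/
theorem transpose_mulVec_eq_zero (hN : N.PosDef) {x : m → ℝ}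
    (h : (B * N⁻¹ * B.transpose) *ᵥ x = 0) : B.transpose *ᵥ x = 0 := by
  by_contra hne
  have h1 := hN.inv.dotProduct_mulVec_pos hne
  rw [star_trivial, ← dotProduct_compress, h, dotProduct_zero] at h1
  exact lt_irrefl _ h1

theorem compress_mulVec_eq_zero {x : m → ℝ} (h : B.transpose *ᵥ x = 0) :
    (B * N⁻¹ * B.transpose) *ᵥ x = 0 := by
  rw [← mulVec_mulVec, h, mulVec_zero]

variable {d μ : m → ℝ} {u v : m → m → ℝ}

/-- The quadratic form of the inverse of `B N⁻¹ Bᵀ` at `B y` is at most `y ⬝ N y`. -/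
theorem sum_overlap_inv_le (hN : N.PosDef) (h : (B * N⁻¹ * B.transpose).IsEigenbasis μ v)
    (y : n → ℝ) : ∑ a, (B *ᵥ y ⬝ᵥ v a) ^ 2 * (μ a)⁻¹ ≤ y ⬝ᵥ N *ᵥ y := by
  set F := B * N⁻¹ * B.transpose with hF
  have hFp : F.PosSemidef := posSemidef_compress hN
  set σ := ∑ a, (B *ᵥ y ⬝ᵥ v a) ^ 2 * (μ a)⁻¹ with hσ
  -- `z` is the pseudo-inverse of `F` applied to `B y`, thanks to `0⁻¹ = 0`. The bound is then `0 ≤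
  -- (y - x) ⬝ᵥ N *ᵥ (y - x)`, as the cross terms and the square of `x` all equal `σ`.
  set z : m → ℝ := ∑ a, ((B *ᵥ y ⬝ᵥ v a) * (μ a)⁻¹) • v a with hz
  set x : n → ℝ := N⁻¹ *ᵥ (B.transpose *ᵥ z) with hx
  have hNx : N *ᵥ x = B.transpose *ᵥ z := hN.mulVec_inv_mulVec _
  have h1 : y ⬝ᵥ N *ᵥ x = σ := by
    rw [hNx, dotProduct_mulVec, vecMul_transpose, hz, dotProduct_sum, hσ]
    refine Finset.sum_congr rfl fun a _ => ?_
    rw [dotProduct_smul, smul_eq_mul]; ring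
  have h2 : x ⬝ᵥ N *ᵥ x = σ := by
    rw [hNx, dotProduct_comm, hx, ← dotProduct_compress, ← hF]
    have hzv : ∀ a, z ⬝ᵥ v a = (B *ᵥ y ⬝ᵥ v a) * (μ a)⁻¹ := by
      intro a
      rw [hz, sum_dotProduct]
      simp [smul_dotProduct, h.orthonormal]
    rw [← h.sum_overlap_mul hFp.isHermitian, hσ]
    refine Finset.sum_congr rfl fun a _ => ?_
    rw [hzv]
    rcases eq_or_ne (μ a) 0 with h0 | h0
    · simp [h0]
    · field_simp
  have h3 : x ⬝ᵥ N *ᵥ y = σ := by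
    rw [← h1, dotProduct_mulVec, ← mulVec_transpose, hN.transpose_eq, dotProduct_comm]
  have h4 := hN.posSemidef.dotProduct_mulVec_nonneg (y - x)
  rw [star_trivial, mulVec_sub, sub_dotProduct, dotProduct_sub, dotProduct_sub, h1, h2, h3] at h4
  linarith

end Compress
end Matrix

/-! ### Two-sided bounds for spectral sums -/

namespace Matrix

variable {m n : Type*} [Fintype m] [DecidableEq m] [Fintype n] [DecidableEq n]
variable {B : Matrix m n ℝ} {N N₀ : Matrix n n ℝ} {d μ : m → ℝ} {u v : m → m → ℝ}

/-- The vector `N⁻¹ Bᵀ u`. -/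
noncomputable def pull (B : Matrix m n ℝ) (N : Matrix n n ℝ) (x : m → ℝ) : n → ℝ :=
  N⁻¹ *ᵥ (B.transpose *ᵥ x)

theorem mulVec_pull (x : m → ℝ) : B *ᵥ pull B N x = (B * N⁻¹ * B.transpose) *ᵥ x := by
  rw [pull, mulVec_mulVec, mulVec_mulVec]

theorem pull_dotProduct_mulVec (hN : N.PosDef) (x : m → ℝ) :
    pull B N x ⬝ᵥ N *ᵥ pull B N x = x ⬝ᵥ (B * N⁻¹ * B.transpose) *ᵥ x := by
  rw [dotProduct_compress, pull, hN.mulVec_inv_mulVec, dotProduct_comm]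

theorem transpose_mulVec_eigenvector_eq_zero (hN : N.PosDef) (h₀ : (B * N⁻¹ * B.transpose).IsEigenbasis d u) {i : m}
    (hi : d i = 0) : B.transpose *ᵥ u i = 0 :=
  transpose_mulVec_eq_zero hN (by rw [h₀.mulVec_eq, hi, zero_smul])

/-- Eigenvectors for non-zero eigenvalues do not overlap with the kernel. -/
theorem overlap_eq_zero_of_ne_zero (hN : N.PosDef)
    (h₀ : (B * N₀⁻¹ * B.transpose).IsEigenbasis d u)
    (h : (B * N⁻¹ * B.transpose).IsEigenbasis μ v) {i a : m} (hi : d i ≠ 0) (ha : μ a = 0) :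
    u i ⬝ᵥ v a = 0 := by
  have h1 := transpose_mulVec_eigenvector_eq_zero hN h ha
  have h2 : d i * (u i ⬝ᵥ v a) = 0 := by
    rw [← smul_eq_mul, ← smul_dotProduct, ← h₀.mulVec_eq, ← mulVec_pull, dotProduct_comm,
      dotProduct_mulVec, ← mulVec_transpose, h1, zero_dotProduct]
  exact (mul_eq_zero.1 h2).resolve_left hi

/-- A tangent bound in the reciprocal eigenvalue gives a bound for the spectral sum that is
linear in `N`. -/
theorem le_spectral_sum (hN₀ : N₀.PosDef) (hN : N.PosDef)
    (h₀ : (B * N₀⁻¹ * B.transpose).IsEigenbasis d u)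
    (h : (B * N⁻¹ * B.transpose).IsEigenbasis μ v) {f : ℝ → ℝ} (hf0 : f 0 = 0)
    (p r : m → ℝ) (hr : ∀ i, d i ≠ 0 → 0 ≤ r i)
    (hp : ∀ i, d i ≠ 0 → ∀ t, 0 < t → p i - r i * t⁻¹ ≤ f t) :
    ∑ i, (if d i = 0 then 0 else
      p i - r i * ((d i)⁻¹ ^ 2 * (pull B N₀ (u i) ⬝ᵥ N *ᵥ pull B N₀ (u i)))) ≤ ∑ a, f (μ a) := by
  rw [h₀.sum_eq_sum_overlap h f]
  refine Finset.sum_le_sum fun i _ => ?_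
  have hμ := h.nonneg (posSemidef_compress hN)
  split_ifs with hi
  -- A kernel vector `u i` overlaps only with kernel vectors `v a`, which contribute `f 0 = 0`.
  · refine (Finset.sum_eq_zero fun a _ => ?_).ge
    by_cases ha : μ a = 0
    · rw [ha, hf0, mul_zero]
    · rw [dotProduct_comm, overlap_eq_zero_of_ne_zero hN₀ h h₀ ha hi]; simp
  · have h1 : ∑ a, (u i ⬝ᵥ v a) ^ 2 * (p i - r i * (μ a)⁻¹) ≤ ∑ a, (u i ⬝ᵥ v a) ^ 2 * f (μ a) := by
      refine Finset.sum_le_sum fun a _ => ?_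
      by_cases ha : μ a = 0
      · rw [overlap_eq_zero_of_ne_zero hN h₀ h hi ha]; simp
      · exact mul_le_mul_of_nonneg_left (hp i hi _ (lt_of_le_of_ne (hμ a) (Ne.symm ha)))
          (sq_nonneg _)
    refine le_trans ?_ h1
    -- This vector is a preimage of `u i` under `B`, and it does not depend on `N`; hence the bound
    -- is linear in `N`.
    have h2 := sum_overlap_inv_le hN h ((d i)⁻¹ • pull B N₀ (u i))
    rw [mulVec_smul, mulVec_pull, h₀.mulVec_eq, smul_smul, inv_mul_cancel₀ hi, one_smul,
      mulVec_smul, smul_dotProduct, dotProduct_smul, smul_eq_mul, smul_eq_mul, ← mul_assoc,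
      ← sq] at h2
    have h3 : ∑ a, (u i ⬝ᵥ v a) ^ 2 * (p i - r i * (μ a)⁻¹) =
        p i * ∑ a, (u i ⬝ᵥ v a) ^ 2 - r i * ∑ a, (u i ⬝ᵥ v a) ^ 2 * (μ a)⁻¹ := by
      rw [Finset.mul_sum, Finset.mul_sum, ← Finset.sum_sub_distrib]
      exact Finset.sum_congr rfl fun a _ => by ring
    rw [h3, h.sum_sq, h₀.norm_one, mul_one]
    exact sub_le_sub_left (mul_le_mul_of_nonneg_left h2 (hr i hi)) _

/-- A quadratic upper bound for `f` gives a quadratic upper bound for the spectral sum. -/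
theorem spectral_sum_le (hN₀ : N₀.PosDef) (hN : N.PosDef)
    (h₀ : (B * N₀⁻¹ * B.transpose).IsEigenbasis d u)
    (h : (B * N⁻¹ * B.transpose).IsEigenbasis μ v) {f : ℝ → ℝ} (hf0 : f 0 = 0)
    (r : m → ℝ) (K : m → ℝ)
    (hp : ∀ i, d i ≠ 0 → ∀ a, 0 < μ a →
      f (μ a) ≤ f (d i) + r i * (μ a - d i) + K i * (μ a - d i) ^ 2) :
    ∑ a, f (μ a) ≤ ∑ i, f (d i) +
      ∑ i, (r i * (u i ⬝ᵥ (B * N⁻¹ * B.transpose - B * N₀⁻¹ * B.transpose) *ᵥ u i) +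
        K i * (((B * N⁻¹ * B.transpose - B * N₀⁻¹ * B.transpose) *ᵥ u i) ⬝ᵥ
          ((B * N⁻¹ * B.transpose - B * N₀⁻¹ * B.transpose) *ᵥ u i))) := by
  rw [h₀.sum_eq_sum_overlap h f, ← Finset.sum_add_distrib]
  refine Finset.sum_le_sum fun i _ => ?_
  have hμ := h.nonneg (posSemidef_compress hN)
  by_cases hi : d i = 0
  · have h1 := transpose_mulVec_eigenvector_eq_zero hN₀ h₀ hi
    rw [sub_mulVec, compress_mulVec_eq_zero h1, compress_mulVec_eq_zero h1, hi, hf0]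
    simp only [sub_zero, dotProduct_zero, mul_zero, add_zero]
    refine (Finset.sum_eq_zero fun a _ => ?_).le
    by_cases ha : μ a = 0
    · rw [ha, hf0, mul_zero]
    · rw [dotProduct_comm, overlap_eq_zero_of_ne_zero hN₀ h h₀ ha hi]; simp
  · have hH := (posSemidef_compress (B := B) hN).isHermitian
    have h1 : ∑ a, (u i ⬝ᵥ v a) ^ 2 * f (μ a) ≤ ∑ a, (u i ⬝ᵥ v a) ^ 2 *
        (f (d i) + r i * (μ a - d i) + K i * (μ a - d i) ^ 2) := by
      refine Finset.sum_le_sum fun a _ => ?_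
      by_cases ha : μ a = 0
      · rw [overlap_eq_zero_of_ne_zero hN h₀ h hi ha]; simp
      · exact mul_le_mul_of_nonneg_left (hp i hi _ (lt_of_le_of_ne (hμ a) (Ne.symm ha)))
          (sq_nonneg _)
    refine h1.trans_eq ?_
    rw [← h₀.sum_overlap_sq h hH, sub_mulVec, dotProduct_sub, ← h.sum_overlap_mul hH,
      h₀.dotProduct_mulVec_eq]
    have h3 : ∑ a, (u i ⬝ᵥ v a) ^ 2 *
        (f (d i) + r i * (μ a - d i) + K i * (μ a - d i) ^ 2) =
        (f (d i) - r i * d i) * ∑ a, (u i ⬝ᵥ v a) ^ 2 + r i * ∑ a, (u i ⬝ᵥ v a) ^ 2 * μ a +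
          K i * ∑ a, (u i ⬝ᵥ v a) ^ 2 * (μ a - d i) ^ 2 := by
      rw [Finset.mul_sum, Finset.mul_sum, Finset.mul_sum, ← Finset.sum_add_distrib,
        ← Finset.sum_add_distrib]
      exact Finset.sum_congr rfl fun a _ => by ring
    rw [h3, h.sum_sq, h₀.norm_one]
    ring

end Matrix

/-! ### One-sided derivatives of spectral traces -/

theorem hasDerivWithinAt_of_squeeze {T g : ℝ → ℝ} {L : ℝ} (hg : ContinuousAt g 0) (hg0 : g 0 = L)
    (hlow : ∀ᶠ α in 𝓝[>] (0 : ℝ), T 0 + α * L ≤ T α)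
    (hup : ∀ᶠ α in 𝓝[>] (0 : ℝ), T α ≤ T 0 + α * g α) :
    HasDerivWithinAt T L (Set.Ici 0) 0 := by
  rw [← hasDerivWithinAt_Ioi_iff_Ici, hasDerivWithinAt_iff_tendsto_slope' (by simp)]
  have hg' : Tendsto g (𝓝[>] 0) (𝓝 L) := by
    rw [← hg0]; exact hg.tendsto.mono_left nhdsWithin_le_nhds
  refine tendsto_of_tendsto_of_tendsto_of_le_of_le' tendsto_const_nhds hg' ?_ ?_
  · filter_upwards [hlow, self_mem_nhdsWithin] with α h (hα : 0 < α)
    rw [slope_def_field, sub_zero, le_div_iff₀ hα]; linarith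
  · filter_upwards [hup, self_mem_nhdsWithin] with α h (hα : 0 < α)
    rw [slope_def_field, sub_zero, div_le_iff₀ hα]; linarith

namespace Matrix

variable {m n : Type*} [Fintype m] [DecidableEq m] [Fintype n] [DecidableEq n]
variable {B : Matrix m n ℝ} {N N₀ D : Matrix n n ℝ} {d μ : m → ℝ} {u v : m → m → ℝ}

theorem continuousAt_inv_add_smul (hN₀ : N₀.PosDef) (D : Matrix n n ℝ) :
    ContinuousAt (fun α : ℝ => (N₀ + α • D)⁻¹) 0 := by
  have h1 : ContinuousAt (fun α : ℝ => N₀ + α • D) 0 := by fun_prop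
  have h2 : ContinuousAt Inv.inv (N₀ + (0 : ℝ) • D) := by
    rw [zero_smul, add_zero]
    refine continuousAt_matrix_inv _ ?_
    have := (isUnit_iff_isUnit_det N₀).1 hN₀.isUnit
    rw [Ring.inverse_eq_inv']
    exact continuousAt_inv₀ this.ne_zero
  exact ContinuousAt.comp (f := fun α : ℝ => N₀ + α • D) h2 h1

/-- The resolvent identity `(N₀ + α D)⁻¹ - N₀⁻¹ = -α (N₀ + α D)⁻¹ D N₀⁻¹`, between `B` and `Bᵀ`. -/
theorem compress_sub_mulVec (hN₀ : N₀.PosDef) {α : ℝ} (hN : (N₀ + α • D).PosDef) (x : m → ℝ) :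
    (B * (N₀ + α • D)⁻¹ * B.transpose - B * N₀⁻¹ * B.transpose) *ᵥ x =
      -(α • (B *ᵥ ((N₀ + α • D)⁻¹ *ᵥ (D *ᵥ pull B N₀ x)))) := by
  have h1 : (N₀ + α • D)⁻¹ *ᵥ (N₀ *ᵥ pull B N₀ x) + α • (N₀ + α • D)⁻¹ *ᵥ (D *ᵥ pull B N₀ x) =
      pull B N₀ x := by
    rw [← mulVec_smul, ← mulVec_add, ← smul_mulVec, ← add_mulVec, mulVec_mulVec,
      nonsing_inv_mul _ ((isUnit_iff_isUnit_det _).1 hN.isUnit), one_mulVec]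
  rw [sub_mulVec, ← mulVec_pull, ← mulVec_pull, ← mulVec_sub, ← mulVec_smul, ← mulVec_neg]
  congr 1
  rw [sub_eq_iff_eq_add, neg_add_eq_sub, eq_sub_iff_add_eq]
  rw [pull, hN₀.mulVec_inv_mulVec] at h1
  exact h1

/-- The derivative of `N ↦ tr f(B N⁻¹ Bᵀ)` at `N₀` when `r i` is the derivative of `f` at the
eigenvalue `d i`. -/
noncomputable def spectralDeriv (B : Matrix m n ℝ) (N₀ : Matrix n n ℝ) (u : m → m → ℝ)
    (r : m → ℝ) : Matrix n n ℝ →ₗ[ℝ] ℝ where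
  toFun D := -∑ i, r i * (pull B N₀ (u i) ⬝ᵥ D *ᵥ pull B N₀ (u i))
  map_add' D D' := by
    simp only [add_mulVec, dotProduct_add, mul_add, Finset.sum_add_distrib, neg_add]
  map_smul' c D := by
    simp only [smul_mulVec, dotProduct_smul, smul_eq_mul, RingHom.id_apply, mul_neg,
      Finset.mul_sum]
    congr 1
    exact Finset.sum_congr rfl fun i _ => by ring

theorem spectralDeriv_apply (r : m → ℝ) : spectralDeriv B N₀ u r D =
    -∑ i, r i * (pull B N₀ (u i) ⬝ᵥ D *ᵥ pull B N₀ (u i)) := rfl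

theorem spectralDeriv_self (hN₀ : N₀.PosDef) (h₀ : (B * N₀⁻¹ * B.transpose).IsEigenbasis d u)
    (r : m → ℝ) : spectralDeriv B N₀ u r N₀ = -∑ i, r i * d i := by
  simp_rw [spectralDeriv_apply, pull_dotProduct_mulVec hN₀, h₀.dotProduct_mulVec_eq]

/-- `tr f(B N⁻¹ Bᵀ)` lies above its tangent if `f` lies above its tangents in the reciprocal
variable. -/
theorem add_spectralDeriv_le (hN₀ : N₀.PosDef) (hN : N.PosDef)
    (h₀ : (B * N₀⁻¹ * B.transpose).IsEigenbasis d u) {f : ℝ → ℝ} (hf0 : f 0 = 0) {r : m → ℝ}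
    (hr : ∀ i, d i ≠ 0 → 0 ≤ r i)
    (hp : ∀ i, d i ≠ 0 → ∀ t, 0 < t → f (d i) + r i * d i - r i * d i ^ 2 * t⁻¹ ≤ f t) :
    ∑ i, f (d i) + spectralDeriv B N₀ u r (N - N₀) ≤ (cfc f (B * N⁻¹ * B.transpose)).trace := by
  obtain ⟨μ, v, h, -, -, hf⟩ := (posSemidef_compress (B := B) hN).isHermitian.exists_isEigenbasis
  rw [hf]
  refine le_trans (le_of_eq ?_) (le_spectral_sum hN₀ hN h₀ h hf0 _ (fun i => r i * d i ^ 2)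
    (fun i hi => mul_nonneg (hr i hi) (sq_nonneg _)) hp)
  rw [map_sub, spectralDeriv_self hN₀ h₀, spectralDeriv_apply, sub_neg_eq_add, ← add_assoc,
    ← sub_eq_add_neg, ← Finset.sum_sub_distrib, ← Finset.sum_add_distrib]
  refine Finset.sum_congr rfl fun i _ => ?_
  split_ifs with hi
  · rw [pull, transpose_mulVec_eigenvector_eq_zero hN₀ h₀ hi, hi, hf0]; simp
  · field_simp; ring

/-- Squeeze between the tangent from `add_spectralDeriv_le` and the majorant from `spectral_sum_le`,
whose quadratic term is `O(α²)`. -/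
theorem hasDerivWithinAt_trace_cfc (hN₀ : N₀.PosDef)
    (h₀ : (B * N₀⁻¹ * B.transpose).IsEigenbasis d u) {f : ℝ → ℝ} (hf0 : f 0 = 0)
    {r : m → ℝ} (hr : ∀ i, d i ≠ 0 → 0 ≤ r i)
    (hp : ∀ i, d i ≠ 0 → ∀ t, 0 < t → f (d i) + r i * d i - r i * d i ^ 2 * t⁻¹ ≤ f t)
    (hup : ∀ b, ∃ K : m → ℝ, ∀ i, d i ≠ 0 → ∀ t, 0 < t → t ≤ b →
      f t ≤ f (d i) + r i * (t - d i) + K i * (t - d i) ^ 2)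
    (hf₀ : (cfc f (B * N₀⁻¹ * B.transpose)).trace = ∑ i, f (d i))
    (hD : ∀ᶠ α : ℝ in 𝓝[>] 0, (N₀ + α • D).PosDef) :
    HasDerivWithinAt (fun α : ℝ => (cfc f (B * (N₀ + α • D)⁻¹ * B.transpose)).trace)
      (spectralDeriv B N₀ u r D) (Set.Ici 0) 0 := by
  -- Eigenvalues are non-negative, hence at most the trace, which stays below `b` for small `α`; so
  -- one `K` serves all these `α`.
  set b := (B * N₀⁻¹ * B.transpose).trace + 1 with hb
  obtain ⟨K, hK⟩ := hup b
  have hinv := continuousAt_inv_add_smul hN₀ D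
  have hb' : ∀ᶠ α : ℝ in 𝓝[>] 0, (B * (N₀ + α • D)⁻¹ * B.transpose).trace ≤ b := by
    have h1 : ContinuousAt (fun α : ℝ => (B * (N₀ + α • D)⁻¹ * B.transpose).trace) 0 := by
      fun_prop
    have h2 := h1.tendsto.eventually_le_const (u := b) (by simp [hb])
    exact h2.filter_mono nhdsWithin_le_nhds
  set z : ℝ → m → m → ℝ := fun α i =>
    B *ᵥ ((N₀ + α • D)⁻¹ *ᵥ (D *ᵥ pull B N₀ (u i))) with hz
  refine hasDerivWithinAt_of_squeeze (g := fun α => ∑ i, (-(r i * (u i ⬝ᵥ z α i)) +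
    α * (K i * (z α i ⬝ᵥ z α i)))) ?_ ?_ ?_ ?_
  · have hzc : ∀ i, ContinuousAt (fun α => z α i) 0 := by
      intro i
      simp only [hz]
      fun_prop
    fun_prop
  · simp only [zero_mul, add_zero, hz, zero_smul, Finset.sum_neg_distrib, spectralDeriv_apply]
    congr 1
    refine Finset.sum_congr rfl fun i _ => ?_
    congr 1
    rw [dotProduct_mulVec, ← mulVec_transpose, dotProduct_mulVec, ← mulVec_transpose,
      hN₀.inv.transpose_eq, pull]
  · filter_upwards [hD] with α hα
    have := add_spectralDeriv_le hN₀ hα h₀ hf0 hr hp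
    rw [add_sub_cancel_left, map_smul, smul_eq_mul] at this
    simpa [hf₀] using this
  · filter_upwards [hD, hb'] with α hα hbα
    obtain ⟨μ, v, h, -, htr, hf⟩ :=
      (posSemidef_compress (B := B) hα).isHermitian.exists_isEigenbasis
    have hμ := h.nonneg (posSemidef_compress hα)
    have h1 := spectral_sum_le hN₀ hα h₀ h hf0 r K fun i hi a ha => hK i hi _ ha <|
      (Finset.single_le_sum (fun a _ => hμ a) (Finset.mem_univ a)).trans (htr ▸ hbα)
    simp only [zero_smul, add_zero, hf₀, hf]
    refine h1.trans_eq ?_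
    congr 1
    rw [Finset.mul_sum]
    refine Finset.sum_congr rfl fun i _ => ?_
    rw [compress_sub_mulVec hN₀ hα]
    simp only [hz, dotProduct_neg, neg_dotProduct, smul_dotProduct, dotProduct_smul, smul_eq_mul]
    ring

end Matrix

/-! ### Scalar inequalities for powers -/

namespace Real

/-- The function `t ↦ t ^ p` lies above its tangents in the variable `t⁻¹`. -/
theorem rpow_tangent_inv_le {p x t : ℝ} (hp : 0 < p) (hx : 0 < x) (ht : 0 < t) :
    (1 + p) * x ^ p - p * x ^ (p + 1) * t⁻¹ ≤ t ^ p := by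
  have h1 : 1 - p * (x / t - 1) ≤ (t / x) ^ p := by
    have h2 := Real.log_le_sub_one_of_pos (div_pos hx ht)
    have h3 := Real.add_one_le_exp (-(p * Real.log (x / t)))
    rw [Real.rpow_def_of_pos (div_pos ht hx), ← inv_div x t, Real.log_inv]
    have h4 := mul_le_mul_of_nonneg_left h2 hp.le
    calc _ ≤ -(p * Real.log (x / t)) + 1 := by linarith
      _ ≤ _ := h3
      _ = _ := by congr 1; ring
  have h5 := mul_le_mul_of_nonneg_left h1 (Real.rpow_pos_of_pos hx p).le
  rw [← Real.mul_rpow hx.le (div_pos ht hx).le, mul_div_cancel₀ _ hx.ne'] at h5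
  refine le_trans (le_of_eq ?_) h5
  rw [Real.rpow_add_one hx.ne']; field_simp; ring

/-- Bernoulli's inequality with exponent `max 1 r`, at `x⁻¹` if `1 ≤ x` and at `x` otherwise; `1 + b
^ max 1 r` dominates both `x ^ max 1 r` and `1`. -/
theorem rpow_sub_one_mul_le {r x b : ℝ} (hx : 0 < x) (hb : x ≤ b) :
    (x ^ r - 1) * (x - 1) ≤ max 1 r * (1 + b ^ max 1 r) * (x - 1) ^ 2 := by
  set R := max 1 r
  have hR : 1 ≤ R := le_max_left _ _
  have hrR : r ≤ R := le_max_right _ _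
  have hbR : x ^ R ≤ b ^ R := Real.rpow_le_rpow hx.le hb (by linarith)
  have hxR := Real.rpow_pos_of_pos hx R
  rcases le_total 1 x with h1 | h1
  · have h2 : x ^ r ≤ x ^ R := Real.rpow_le_rpow_of_exponent_le h1 hrR
    have h3 := one_add_mul_self_le_rpow_one_add (s := x⁻¹ - 1)
      (by have := inv_pos.2 hx; linarith) hR
    rw [add_sub_cancel, Real.inv_rpow hx.le] at h3
    have h4 : x ^ R - 1 ≤ R * x ^ R * (1 - x⁻¹) := by
      have := mul_le_mul_of_nonneg_left h3 hxR.le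
      rw [mul_inv_cancel₀ hxR.ne'] at this
      linarith
    have h5 : 1 - x⁻¹ ≤ x - 1 := by
      have := mul_inv_cancel₀ hx.ne'
      have h6 := sq_nonneg (x - 1)
      have : x⁻¹ * (x - 1) ^ 2 = x - 2 + x⁻¹ := by field_simp; ring
      have : 0 ≤ x⁻¹ * (x - 1) ^ 2 := by positivity
      linarith
    have h7 : x ^ r - 1 ≤ R * (1 + b ^ R) * (x - 1) := by
      calc x ^ r - 1 ≤ R * x ^ R * (1 - x⁻¹) := by linarith
        _ ≤ R * x ^ R * (x - 1) := mul_le_mul_of_nonneg_left h5 (by positivity)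
        _ ≤ R * (1 + b ^ R) * (x - 1) := by
          refine mul_le_mul_of_nonneg_right (mul_le_mul_of_nonneg_left ?_ ?_) ?_ <;> linarith
    nlinarith
  · have h2 : x ^ R ≤ x ^ r := Real.rpow_le_rpow_of_exponent_ge hx h1 hrR
    have h3 := one_add_mul_self_le_rpow_one_add (s := x - 1) (by linarith) hR
    rw [add_sub_cancel] at h3
    have h4 : 1 - x ^ r ≤ R * (1 + b ^ R) * (1 - x) := by
      have : 0 ≤ R * b ^ R * (1 - x) :=
        mul_nonneg (mul_nonneg (by linarith) (hxR.le.trans hbR)) (by linarith)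
      nlinarith
    nlinarith

/-- After scaling to `d = 1`: for `p ≤ 1` concavity allows `K = 0`; for `p ≥ 1` Bernoulli at `x⁻¹`
gives `x ^ p ≤ 1 + p x ^ (p - 1) (x - 1)`, and the excess over the tangent is controlled by
`rpow_sub_one_mul_le`. -/
theorem exists_rpow_le_quadratic {p d : ℝ} (hp : 0 < p) (hd : 0 < d) (b : ℝ) :
    ∃ K, ∀ t, 0 < t → t ≤ b → t ^ p ≤ d ^ p + p * d ^ (p - 1) * (t - d) + K * (t - d) ^ 2 := by
  obtain ⟨K, hK⟩ : ∃ K, ∀ x, 0 < x → x ≤ b / d → x ^ p ≤ 1 + p * (x - 1) + K * (x - 1) ^ 2 := by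
    rcases le_total p 1 with h | h
    · refine ⟨0, fun x hx _ => ?_⟩
      have := rpow_one_add_le_one_add_mul_self (s := x - 1) (by linarith) hp.le h
      rw [add_sub_cancel] at this
      linarith
    · refine ⟨p * (max 1 (p - 1) * (1 + (b / d) ^ max 1 (p - 1))), fun x hx hxb => ?_⟩
      have h1 := rpow_sub_one_mul_le (r := p - 1) hx hxb
      have h2 := one_add_mul_self_le_rpow_one_add (s := x⁻¹ - 1)
        (by have := inv_pos.2 hx; linarith) h
      rw [add_sub_cancel, Real.inv_rpow hx.le] at h2
      have hxp := Real.rpow_pos_of_pos hx p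
      have h3 := mul_le_mul_of_nonneg_left h2 hxp.le
      rw [mul_inv_cancel₀ hxp.ne'] at h3
      have h4 : x ^ p = x ^ (p - 1) * x := by
        rw [← Real.rpow_add_one hx.ne', sub_add_cancel]
      have h5 : x ^ p * (1 + p * (x⁻¹ - 1)) = x ^ p + p * x ^ (p - 1) * (1 - x) := by
        rw [h4]; field_simp
      have h6 := mul_le_mul_of_nonneg_left h1 hp.le
      linarith
  refine ⟨d ^ p * K / d ^ 2, fun t ht htb => ?_⟩
  have h1 := hK (t / d) (div_pos ht hd) (div_le_div_of_nonneg_right htb hd.le)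
  have h2 := mul_le_mul_of_nonneg_left h1 (Real.rpow_pos_of_pos hd p).le
  rw [← Real.mul_rpow hd.le (div_pos ht hd).le, mul_div_cancel₀ _ hd.ne'] at h2
  refine h2.trans_eq ?_
  rw [Real.rpow_sub_one hd.ne']
  field_simp

end Real

/-! ### Tangents of the criteria as functions of the information matrix -/

namespace Matrix

variable {m n : Type*} [Fintype m] [DecidableEq m] [Fintype n] [DecidableEq n]
variable {B : Matrix m n ℝ} {N N₀ D : Matrix n n ℝ} {d μ : m → ℝ} {u v : m → m → ℝ}

/-- `L` is the directional derivative of `Ψ` at `N₀` and a subgradient on the positive definite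
matrices. -/
def HasTangent (Ψ : Matrix n n ℝ → ℝ) (N₀ : Matrix n n ℝ) (L : Matrix n n ℝ →ₗ[ℝ] ℝ) : Prop :=
  (∀ N, N.PosDef → Ψ N₀ + L (N - N₀) ≤ Ψ N) ∧
    ∀ D, (∀ᶠ α : ℝ in 𝓝[>] 0, (N₀ + α • D).PosDef) →
      HasDerivWithinAt (fun α : ℝ => Ψ (N₀ + α • D)) (L D) (Set.Ici 0) 0

theorem HasTangent.congr {Ψ Ψ' : Matrix n n ℝ → ℝ} {L : Matrix n n ℝ →ₗ[ℝ] ℝ}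
    (h : HasTangent Ψ N₀ L) (hN₀ : N₀.PosDef) (hΨ : ∀ N, N.PosDef → Ψ' N = Ψ N) :
    HasTangent Ψ' N₀ L := by
  refine ⟨fun N hN => ?_, fun D hD => ?_⟩
  · rw [hΨ N hN, hΨ N₀ hN₀]; exact h.1 N hN
  · rw [← hasDerivWithinAt_Ioi_iff_Ici]
    refine (h.2 D hD).Ioi_of_Ici.congr_of_eventuallyEq ?_ ?_
    · filter_upwards [hD] with α hα using hΨ _ hα
    · simpa using hΨ N₀ hN₀

theorem HasTangent.exp_const_mul {Ψ : Matrix n n ℝ → ℝ} {L : Matrix n n ℝ →ₗ[ℝ] ℝ}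
    (h : HasTangent Ψ N₀ L) {a : ℝ} (ha : 0 ≤ a) :
    HasTangent (fun N => Real.exp (a * Ψ N)) N₀ ((Real.exp (a * Ψ N₀) * a) • L) := by
  refine ⟨fun N hN => ?_, fun D hD => ?_⟩
  · have h1 := mul_le_mul_of_nonneg_left (h.1 N hN) ha
    have h2 := Real.add_one_le_exp (a * L (N - N₀))
    have h3 := mul_le_mul_of_nonneg_left h2 (Real.exp_pos (a * Ψ N₀)).le
    rw [← Real.exp_add] at h3
    have h4 := Real.exp_le_exp.2 h1
    rw [mul_add] at h4
    simp only [LinearMap.smul_apply, smul_eq_mul]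
    linarith
  · have := ((h.2 D hD).const_mul a).exp
    simpa [mul_assoc] using this

/-- The tangents are taken at `s * d i` instead of `d i`; the free scale `s` is what lets the bound
survive the root of order `p`. -/
theorem le_trace_rpow {p : ℝ} (hp : 0 < p) (hN₀ : N₀.PosDef) (hN : N.PosDef)
    (h₀ : (B * N₀⁻¹ * B.transpose).IsEigenbasis d u) {s : ℝ} (hs : 0 < s) :
    s ^ p * ((1 + p) * ∑ i, d i ^ p +
      s * spectralDeriv B N₀ u (fun i => p * d i ^ (p - 1)) N) ≤
      (cfc (fun t : ℝ => t ^ p) (B * N⁻¹ * B.transpose)).trace := by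
  obtain ⟨μ, v, h, -, -, hf⟩ := (posSemidef_compress (B := B) hN).isHermitian.exists_isEigenbasis
  rw [hf]
  have hd := h₀.nonneg (posSemidef_compress hN₀)
  have hd' : ∀ i, d i ≠ 0 → 0 < d i := fun i hi => lt_of_le_of_ne (hd i) (Ne.symm hi)
  refine le_trans (le_of_eq ?_) (le_spectral_sum hN₀ hN h₀ h (f := fun t => t ^ p)
    (Real.zero_rpow hp.ne') (fun i => (1 + p) * (s * d i) ^ p)
    (fun i => p * (s * d i) ^ (p + 1)) (fun i hi => ?_) fun i hi t ht =>
      Real.rpow_tangent_inv_le hp (mul_pos hs (hd' i hi)) ht)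
  · rw [spectralDeriv_apply, mul_neg, ← sub_eq_add_neg, Finset.mul_sum, Finset.mul_sum,
      ← Finset.sum_sub_distrib, Finset.mul_sum]
    refine Finset.sum_congr rfl fun i _ => ?_
    split_ifs with hi
    · rw [pull, transpose_mulVec_eigenvector_eq_zero hN₀ h₀ hi, hi, Real.zero_rpow hp.ne']; simp
    · have := hd' i hi
      rw [Real.mul_rpow hs.le this.le, Real.mul_rpow hs.le this.le, Real.rpow_add_one hs.ne',
        Real.rpow_add_one this.ne', Real.rpow_sub_one this.ne']
      field_simp
  · have := hd' i hi
    positivity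

/-- For `p > 1` the outer root is concave, so a tangent bound for the trace alone does not suffice;
the scale in `le_trace_rpow` is adapted to `N`. -/
theorem exists_hasTangent_trace_rpow {p a : ℝ} (hp : 0 < p) (ha : 0 ≤ a) (hN₀ : N₀.PosDef)
    (hpos : 0 < (a * (cfc (fun t : ℝ => t ^ p) (B * N₀⁻¹ * B.transpose)).trace) ^ (1 / p)) :
    ∃ L, HasTangent
      (fun N => (a * (cfc (fun t : ℝ => t ^ p) (B * N⁻¹ * B.transpose)).trace) ^ (1 / p)) N₀ L := by
  obtain ⟨d, u, h₀, -, -, hf⟩ :=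
    (posSemidef_compress (B := B) hN₀).isHermitian.exists_isEigenbasis
  have hd := h₀.nonneg (posSemidef_compress hN₀)
  have hd' : ∀ i, d i ≠ 0 → 0 < d i := fun i hi => lt_of_le_of_ne (hd i) (Ne.symm hi)
  set T : Matrix n n ℝ → ℝ := fun N => (cfc (fun t : ℝ => t ^ p) (B * N⁻¹ * B.transpose)).trace
    with hT
  have hT0 : T N₀ = ∑ i, d i ^ p := hf _
  have hTnn : ∀ N, N.PosDef → 0 ≤ T N := by
    intro N hN
    obtain ⟨μ, v, h, -, -, hf⟩ :=
      (posSemidef_compress (B := B) hN).isHermitian.exists_isEigenbasis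
    rw [hT]; dsimp only; rw [hf]
    exact Finset.sum_nonneg fun a _ => Real.rpow_nonneg (h.nonneg (posSemidef_compress hN) a) _
  have haT : 0 < a * T N₀ := by
    refine lt_of_le_of_ne (mul_nonneg ha (hTnn _ hN₀)) fun h => ?_
    change 0 < (a * T N₀) ^ (1 / p) at hpos
    rw [← h, Real.zero_rpow (by positivity)] at hpos
    exact lt_irrefl _ hpos
  have hTpos : 0 < T N₀ := by
    refine lt_of_le_of_ne (hTnn _ hN₀) fun h => ?_
    rw [← h, mul_zero] at haT
    exact lt_irrefl _ haT
  set r : m → ℝ := fun i => p * d i ^ (p - 1) with hr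
  have hself : spectralDeriv B N₀ u r N₀ = -(p * T N₀) := by
    rw [spectralDeriv_self hN₀ h₀, hT0, Finset.mul_sum]
    congr 1
    refine Finset.sum_congr rfl fun i _ => ?_
    by_cases hi : d i = 0
    · rw [hi, mul_zero, Real.zero_rpow hp.ne', mul_zero]
    · rw [hr]; dsimp only; rw [Real.rpow_sub_one hi]; field_simp
  refine ⟨((a * T N₀) ^ (1 / p) * (p * T N₀)⁻¹) • spectralDeriv B N₀ u r, fun N hN => ?_,
    fun D hD => ?_⟩
  · change (a * T N₀) ^ (1 / p) + _ ≤ (a * T N) ^ (1 / p)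
    rw [LinearMap.smul_apply, map_sub, hself, smul_eq_mul]
    set Λ := spectralDeriv B N₀ u r N
    -- Chosen so that the candidate tangent at `N` equals `s` times the value at `N₀`. For `s > 0`,
    -- the scaled bound becomes `s ^ p * T N₀ * (1 + p (s - 1) ^ 2) ≤ T N`.
    set s := 2 + (p * T N₀)⁻¹ * Λ with hs
    have h1 : (a * T N₀) ^ (1 / p) + (a * T N₀) ^ (1 / p) * (p * T N₀)⁻¹ * (Λ - -(p * T N₀)) =
        s * (a * T N₀) ^ (1 / p) := by
      rw [hs]; field_simp; ring
    rw [h1]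
    rcases le_or_gt s 0 with hs0 | hs0
    · exact (mul_nonpos_of_nonpos_of_nonneg hs0 hpos.le).trans
        (Real.rpow_nonneg (mul_nonneg ha (hTnn _ hN)) _)
    · have h2 := le_trace_rpow hp hN₀ hN h₀ hs0
      have h3 : Λ = (s - 2) * (p * T N₀) := by rw [hs]; field_simp; ring
      change s ^ p * ((1 + p) * _ + s * Λ) ≤ T N at h2
      rw [← hT0, h3] at h2
      have h4 : s ^ p * T N₀ ≤ T N := by
        refine le_trans ?_ h2
        refine mul_le_mul_of_nonneg_left ?_ (Real.rpow_nonneg hs0.le _)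
        have : 0 ≤ p * T N₀ * (s - 1) ^ 2 := by positivity
        linarith
      calc s * (a * T N₀) ^ (1 / p) = (s ^ p * (a * T N₀)) ^ (1 / p) := by
            rw [Real.mul_rpow (Real.rpow_nonneg hs0.le _) haT.le, ← Real.rpow_mul hs0.le,
              mul_one_div_cancel hp.ne', Real.rpow_one]
        _ ≤ (a * T N) ^ (1 / p) := by
            refine Real.rpow_le_rpow (by positivity) ?_ (by positivity)
            have := mul_le_mul_of_nonneg_left h4 ha
            linarith
  · have h1 : HasDerivWithinAt (fun α : ℝ => T (N₀ + α • D)) (spectralDeriv B N₀ u r D)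
        (Set.Ici 0) 0 := by
      refine hasDerivWithinAt_trace_cfc (f := fun t => t ^ p) hN₀ h₀ (Real.zero_rpow hp.ne')
        (fun i hi => by have := hd' i hi; positivity) (fun i hi t ht => ?_) (fun b => ?_) hT0 hD
      · have h2 := Real.rpow_tangent_inv_le hp (hd' i hi) ht
        refine le_trans (le_of_eq ?_) h2
        have := hd' i hi
        simp only [hr]
        rw [Real.rpow_add_one hi, Real.rpow_sub_one hi]
        field_simp
      · have : ∀ i, ∃ K, d i ≠ 0 → ∀ t, 0 < t → t ≤ b →
            t ^ p ≤ d i ^ p + r i * (t - d i) + K * (t - d i) ^ 2 := by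
          intro i
          by_cases hi : d i = 0
          · exact ⟨0, fun h => absurd hi h⟩
          · obtain ⟨K, hK⟩ := Real.exists_rpow_le_quadratic hp (hd' i hi) b
            exact ⟨K, fun _ => hK⟩
        choose K hK using this
        exact ⟨K, hK⟩
    have h2 := (h1.const_mul a).rpow_const (p := 1 / p)
      (Or.inl (by simpa using haT.ne'))
    refine h2.congr_deriv ?_
    simp only [zero_smul, add_zero, LinearMap.smul_apply, smul_eq_mul]
    have ha' : a ≠ 0 := fun h => by simp [h] at haT
    rw [Real.rpow_sub_one haT.ne']
    field_simp

/-- Singularity at `N` would give a kernel vector of `Bᵀ`, hence singularity at `N₀`. -/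
theorem det_compress_pos (hN : N.PosDef)
    (h : (B * N₀⁻¹ * B.transpose).det ≠ 0) : 0 < (B * N⁻¹ * B.transpose).det := by
  refine lt_of_le_of_ne (posSemidef_compress hN).det_nonneg fun h0 => h ?_
  obtain ⟨x, hx, hx0⟩ := exists_mulVec_eq_zero_iff.2 h0.symm
  exact exists_mulVec_eq_zero_iff.1
    ⟨x, hx, compress_mulVec_eq_zero (transpose_mulVec_eq_zero hN hx0)⟩

theorem log_det_compress (hN : N.PosDef) (h : (B * N⁻¹ * B.transpose).det ≠ 0) :
    Real.log (B * N⁻¹ * B.transpose).det =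
      (cfc Real.log (B * N⁻¹ * B.transpose)).trace := by
  obtain ⟨d, u, -, hdet, -, hf⟩ :=
    (posSemidef_compress (B := B) hN).isHermitian.exists_isEigenbasis
  rw [hf, hdet, Real.log_prod]
  intro i hi
  rw [hdet] at h
  exact Finset.prod_ne_zero_iff.1 h i hi

theorem exists_hasTangent_log_det (hN₀ : N₀.PosDef) (h : (B * N₀⁻¹ * B.transpose).det ≠ 0) :
    ∃ L, HasTangent (fun N => Real.log (B * N⁻¹ * B.transpose).det) N₀ L := by
  obtain ⟨d, u, h₀, -, -, hf⟩ :=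
    (posSemidef_compress (B := B) hN₀).isHermitian.exists_isEigenbasis
  have hd := h₀.nonneg (posSemidef_compress hN₀)
  have hd' : ∀ i, d i ≠ 0 → 0 < d i := fun i hi => lt_of_le_of_ne (hd i) (Ne.symm hi)
  have hr : ∀ i, d i ≠ 0 → 0 ≤ (d i)⁻¹ := fun i _ => inv_nonneg.2 (hd i)
  have hlow : ∀ i, d i ≠ 0 → ∀ t, 0 < t →
      Real.log (d i) + (d i)⁻¹ * d i - (d i)⁻¹ * d i ^ 2 * t⁻¹ ≤ Real.log t := by
    intro i hi t ht
    have h1 := Real.log_le_sub_one_of_pos (div_pos (hd' i hi) ht)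
    rw [Real.log_div hi ht.ne'] at h1
    have h2 : (d i)⁻¹ * d i ^ 2 * t⁻¹ = d i / t := by field_simp
    rw [h2, inv_mul_cancel₀ hi]
    linarith
  have key : HasTangent (fun N => (cfc Real.log (B * N⁻¹ * B.transpose)).trace) N₀
      (spectralDeriv B N₀ u fun i => (d i)⁻¹) := by
    refine ⟨fun N hN => ?_, fun D hD => ?_⟩
    · dsimp only
      rw [hf]
      exact add_spectralDeriv_le hN₀ hN h₀ Real.log_zero hr hlow
    · refine hasDerivWithinAt_trace_cfc hN₀ h₀ Real.log_zero hr hlow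
        -- The logarithm is concave, so its tangent line is already a majorant and `K = 0` works.
        (fun b => ⟨0, fun i hi t ht _ => ?_⟩) (hf _) hD
      have h1 := Real.log_le_sub_one_of_pos (div_pos ht (hd' i hi))
      rw [Real.log_div ht.ne' hi] at h1
      have h2 : (d i)⁻¹ * (t - d i) = t / d i - 1 := by field_simp
      rw [h2, Pi.zero_apply, zero_mul]
      linarith
  exact ⟨_, key.congr hN₀ fun N hN => log_det_compress hN (det_compress_pos hN h).ne'⟩

end Matrix

/-! ### Information matrices and criteria of a model -/

namespace ModelSpec

variable {E : ExpFamily} {Ω : Type*} (M : ModelSpec E Ω)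

theorem w_nonneg (x : Ω) : 0 ≤ M.w x :=
  inv_nonneg.2 (mul_nonneg (variance_nonneg _ _) (sq_nonneg _))

theorem info_eq_linearCombination (ξ : Ω →₀ ℝ) : M.info ξ =
    Finsupp.linearCombination ℝ (fun x => M.w x • Matrix.vecMulVec (M.g x) (M.g x)) ξ := by
  simp only [info, Finsupp.linearCombination_apply, smul_smul]

theorem info_add (ξ ξ' : Ω →₀ ℝ) : M.info (ξ + ξ') = M.info ξ + M.info ξ' := by
  simp only [info_eq_linearCombination, map_add]

theorem info_smul (a : ℝ) (ξ : Ω →₀ ℝ) : M.info (a • ξ) = a • M.info ξ := by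
  simp only [info_eq_linearCombination, map_smul]

theorem info_segment (ξ ξ' : Ω →₀ ℝ) (α : ℝ) :
    M.info ((1 - α) • ξ + α • ξ') = M.info ξ + α • (M.info ξ' - M.info ξ) := by
  rw [info_add, info_smul, info_smul]; module

theorem info_posSemidef {ξ : Ω →₀ ℝ} (h : ∀ x, 0 ≤ ξ x) : (M.info ξ).PosSemidef := by
  refine Matrix.posSemidef_sum _ fun x _ => ?_
  have := Matrix.posSemidef_vecMulVec_self_star (M.g x)
  rw [star_trivial] at this
  exact this.smul (mul_nonneg (h x) (M.w_nonneg x))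

theorem info_posDef {ξ : Ω →₀ ℝ} (h : ∀ x, 0 ≤ ξ x) (hu : IsUnit (M.info ξ).det) :
    (M.info ξ).PosDef :=
  (M.info_posSemidef h).posDef_iff_det_ne_zero.2 hu.ne_zero

/-- The criterion as a function of the information matrix. -/
noncomputable def critOfInfo (c : OptCriterion) (N : Matrix (Fin M.l) (Fin M.l) ℝ) : ℝ :=
  match c with
  | .phi p _ => ((M.q : ℝ)⁻¹ *
      (cfc (fun t : ℝ => t ^ p) (M.jac * N⁻¹ * M.jac.transpose)).trace) ^ (1 / p)
  | .phiZero => (M.jac * N⁻¹ * M.jac.transpose).det ^ (1 / (M.q : ℝ))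
  | .logDet => Real.log (M.jac * N⁻¹ * M.jac.transpose).det

theorem critOfInfo_info (c : OptCriterion) (ξ : Ω →₀ ℝ) :
    M.critOfInfo c (M.info ξ) = Phi c M ξ := by
  cases c <;> rfl

theorem exists_hasTangent (c : OptCriterion) {N₀ : Matrix (Fin M.l) (Fin M.l) ℝ}
    (hN₀ : N₀.PosDef) (hpos : 0 < M.critOfInfo c N₀) :
    ∃ L, Matrix.HasTangent (M.critOfInfo c) N₀ L := by
  cases c with
  | phi p hp => exact Matrix.exists_hasTangent_trace_rpow hp (by positivity) hN₀ hpos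
  | phiZero =>
    have hdet : (M.jac * N₀⁻¹ * M.jac.transpose).det ≠ 0 := by
      intro h
      -- For `q = 0` the exponent `1 / q` is `0`, so positivity of the power says nothing; there the
      -- empty determinant is `1`.
      rcases Nat.eq_zero_or_pos M.q with hq | hq
      · have : IsEmpty (Fin M.q) := by rw [hq]; infer_instance
        rw [Matrix.det_isEmpty] at h
        exact one_ne_zero h
      · simp only [critOfInfo] at hpos
        rw [h, Real.zero_rpow (by positivity)] at hpos
        exact lt_irrefl _ hpos
    obtain ⟨L, hL⟩ := Matrix.exists_hasTangent_log_det hN₀ hdet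
    refine ⟨_, (hL.exp_const_mul (a := 1 / (M.q : ℝ)) (by positivity)).congr hN₀ fun N hN => ?_⟩
    rw [mul_comm, ← Real.rpow_def_of_pos (Matrix.det_compress_pos hN hdet)]
    rfl
  | logDet =>
    refine Matrix.exists_hasTangent_log_det hN₀ fun h => ?_
    simp only [critOfInfo] at hpos
    rw [h, Real.log_zero] at hpos
    exact lt_irrefl _ hpos

end ModelSpec

/-! ### Convexity of `se` over designs -/

section Designs

variable {E : ExpFamily} {Ω : Type*} {ι : Type*} [Fintype ι]

theorem isDesign_single (x : Ω) : IsDesign (Finsupp.single x (1 : ℝ)) := by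
  classical
  refine ⟨fun y => ?_, by simp⟩
  rw [Finsupp.single_apply]
  split_ifs <;> norm_num

theorem IsDesign.segment {ξ ξ' : Ω →₀ ℝ} (h : IsDesign ξ) (h' : IsDesign ξ') {α : ℝ}
    (h0 : 0 ≤ α) (h1 : α ≤ 1) : IsDesign ((1 - α) • ξ + α • ξ') := by
  refine ⟨fun x => ?_, ?_⟩
  · have := mul_nonneg (sub_nonneg.2 h1) (h.1 x)
    have := mul_nonneg h0 (h'.1 x)
    simp only [Finsupp.add_apply, Finsupp.smul_apply, smul_eq_mul]
    linarith
  · have e : ∀ η : Ω →₀ ℝ, (η.sum fun _ lam => lam) =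
        Finsupp.linearCombination ℝ (fun _ => (1 : ℝ)) η := fun η => by
      simp [Finsupp.linearCombination_apply]
    have h2 := h.2
    have h3 := h'.2
    rw [e] at h2 h3 ⊢
    rw [map_add, map_smul, map_smul, h2, h3, smul_eq_mul, smul_eq_mul]; ring

/-- Only `ξ` needs invertible information: for `α < 1` its share keeps the mixture positive
definite, even when `ξ'` is a one-point design. -/
theorem posDef_info_segment (M : ModelSpec E Ω) {ξ ξ' : Ω →₀ ℝ} (h : (M.info ξ).PosDef)
    (h' : ∀ x, 0 ≤ ξ' x) {α : ℝ} (h0 : 0 ≤ α) (h1 : α < 1) :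
    (M.info ξ + α • (M.info ξ' - M.info ξ)).PosDef := by
  rw [← M.info_segment, M.info_add, M.info_smul, M.info_smul]
  exact (h.smul (sub_pos.2 h1)).add_posSemidef ((M.info_posSemidef h').smul h0)

theorem IsRegularForAll.segment {M : ι → ModelSpec E Ω} {ξ ξ' : Ω →₀ ℝ}
    (h : IsRegularForAll M ξ) (h' : IsDesign ξ') {α : ℝ} (h0 : 0 ≤ α) (h1 : α < 1) :
    IsRegularForAll M ((1 - α) • ξ + α • ξ') := by
  refine ⟨h.1.segment h' h0 h1.le, fun j => ?_⟩
  rw [(M j).info_segment]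
  exact (Matrix.isUnit_iff_isUnit_det _).1
    (posDef_info_segment _ ((M j).info_posDef h.1.1 (h.2 j)) h'.1 h0 h1).isUnit

theorem se_eq (c : OptCriterion) (M : ι → ModelSpec E Ω) (ξopt : ι → Ω →₀ ℝ) (ξ : Ω →₀ ℝ) :
    se c M ξopt ξ = ∑ j, Real.exp ((Phi c (M j) (ξopt j))⁻¹ *
      (M j).critOfInfo c ((M j).info ξ)) := by
  simp only [se, eff, one_div_div, ModelSpec.critOfInfo_info]
  exact Finset.sum_congr rfl fun j _ => by rw [inv_mul_eq_div]

/-- The function `se` has linear directional derivatives at a regular design and lies above its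
tangent. -/
theorem exists_se_tangent {c : OptCriterion} {M : ι → ModelSpec E Ω} {ξopt : ι → Ω →₀ ℝ}
    (hopt : ∀ j, IsLocalOptimal c (M j) (ξopt j)) (hpos : ∀ j, 0 < Phi c (M j) (ξopt j))
    {ξ : Ω →₀ ℝ} (hξ : IsRegularForAll M ξ) :
    ∃ G : (Ω →₀ ℝ) →ₗ[ℝ] ℝ,
      (∀ ξ', IsRegularForAll M ξ' → se c M ξopt ξ + (G ξ' - G ξ) ≤ se c M ξopt ξ') ∧
      ∀ ξ', IsDesign ξ' → HasDerivWithinAt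
        (fun α : ℝ => se c M ξopt ((1 - α) • ξ + α • ξ')) (G ξ' - G ξ) (Set.Ici 0) 0 := by
  have hPD : ∀ ξ', IsRegularForAll M ξ' → ∀ j, ((M j).info ξ').PosDef := fun ξ' h j =>
    (M j).info_posDef h.1.1 (h.2 j)
  have : ∀ j, ∃ L, Matrix.HasTangent (fun N => Real.exp ((Phi c (M j) (ξopt j))⁻¹ *
      (M j).critOfInfo c N)) ((M j).info ξ) L := by
    intro j
    -- Local optimality bounds the criterion at `ξ` below by the positive optimum.
    have h1 : 0 < (M j).critOfInfo c ((M j).info ξ) := by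
      rw [ModelSpec.critOfInfo_info]
      exact (hpos j).trans_le ((hopt j).2 ξ ⟨hξ.1, hξ.2 j⟩)
    obtain ⟨L, hL⟩ := (M j).exists_hasTangent c (hPD ξ hξ j) h1
    exact ⟨_, hL.exp_const_mul (inv_nonneg.2 (hpos j).le)⟩
  choose L hL using this
  refine ⟨∑ j, (L j).comp (Finsupp.linearCombination ℝ
    (fun x => (M j).w x • Matrix.vecMulVec ((M j).g x) ((M j).g x))), fun ξ' hξ' => ?_,
    fun ξ' hξ' => ?_⟩
  · simp only [LinearMap.sum_apply, LinearMap.comp_apply, ← ModelSpec.info_eq_linearCombination,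
      ← Finset.sum_sub_distrib, ← map_sub]
    rw [se_eq, se_eq, ← Finset.sum_add_distrib]
    exact Finset.sum_le_sum fun j _ => (hL j).1 _ (hPD ξ' hξ' j)
  · simp only [LinearMap.sum_apply, LinearMap.comp_apply, ← ModelSpec.info_eq_linearCombination,
      ← Finset.sum_sub_distrib, ← map_sub, se_eq, ModelSpec.info_segment]
    refine HasDerivWithinAt.fun_sum fun j _ => (hL j).2 _ ?_
    filter_upwards [Ioo_mem_nhdsGT one_pos] with α hα
    exact posDef_info_segment _ (hPD ξ hξ j) hξ'.1 hα.1.le hα.2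

theorem uniqueDiffWithinAt_Ici_zero : UniqueDiffWithinAt ℝ (Set.Ici (0 : ℝ)) 0 :=
  uniqueDiffOn_Ici 0 0 Set.self_mem_Ici

/-- If the one-point directional derivatives of `se` at a regular design `ξ` are non-negative on
`C`, then no regular design supported in `C` improves on `ξ`. -/
theorem se_le_of_dirDerivAt_nonneg {c : OptCriterion} {M : ι → ModelSpec E Ω}
    {ξopt : ι → Ω →₀ ℝ} (hopt : ∀ j, IsLocalOptimal c (M j) (ξopt j))
    (hpos : ∀ j, 0 < Phi c (M j) (ξopt j)) {ξ ξ' : Ω →₀ ℝ} (hξ : IsRegularForAll M ξ)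
    (hξ' : IsRegularForAll M ξ') {C : Finset Ω} (hC : ξ'.support ⊆ C)
    (h : ∀ y ∈ C, 0 ≤ dirDerivAt c M ξopt y ξ) : se c M ξopt ξ ≤ se c M ξopt ξ' := by
  obtain ⟨G, hG, hG'⟩ := exists_se_tangent hopt hpos hξ
  have h1 : ∀ y ∈ ξ'.support, G ξ ≤ G (Finsupp.single y 1) := by
    intro y hy
    have h2 := h y (hC hy)
    rw [dirDerivAt, dirDeriv, (hG' _ (isDesign_single y)).derivWithin uniqueDiffWithinAt_Ici_zero]
      at h2
    linarith
  -- By linearity `G ξ'` is the weighted mean of the one-point values, each at least `G ξ`.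
  have h3 : G ξ' = ∑ y ∈ ξ'.support, ξ' y * G (Finsupp.single y 1) := by
    conv_lhs => rw [← Finsupp.sum_single ξ', Finsupp.sum, map_sum]
    refine Finset.sum_congr rfl fun y _ => ?_
    rw [← smul_eq_mul, ← map_smul, Finsupp.smul_single, smul_eq_mul, mul_one]
  have h4 : G ξ ≤ G ξ' := by
    have h5 : ∑ y ∈ ξ'.support, ξ' y = 1 := hξ'.1.2
    rw [h3]
    calc G ξ = ∑ y ∈ ξ'.support, ξ' y * G ξ := by rw [← Finset.sum_mul, h5, one_mul]
      _ ≤ _ := Finset.sum_le_sum fun y hy => mul_le_mul_of_nonneg_left (h1 y hy) (hξ'.1.1 y)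
  have := hG ξ' hξ'
  linarith

/-- Shifting a fraction `α < 1` of the mass to a point of `S` gives a regular competitor supported
in `S`, so the difference quotients are non-negative. -/
theorem HasOptimalWeights.dirDerivAt_nonneg {c : OptCriterion} {M : ι → ModelSpec E Ω}
    {ξopt : ι → Ω →₀ ℝ} (hopt : ∀ j, IsLocalOptimal c (M j) (ξopt j))
    (hpos : ∀ j, 0 < Phi c (M j) (ξopt j)) {S : Finset Ω} {ξ : Ω →₀ ℝ}
    (h : HasOptimalWeights c M ξopt S ξ) {x : Ω} (hx : x ∈ S) :
    0 ≤ dirDerivAt c M ξopt x ξ := by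
  classical
  obtain ⟨G, -, hG⟩ := exists_se_tangent hopt hpos h.2.1
  have hd := hG _ (isDesign_single x)
  rw [dirDerivAt, dirDeriv, hd.derivWithin uniqueDiffWithinAt_Ici_zero]
  rw [← hasDerivWithinAt_Ioi_iff_Ici, hasDerivWithinAt_iff_tendsto_slope' (by simp)] at hd
  refine ge_of_tendsto hd ?_
  filter_upwards [Ioo_mem_nhdsGT one_pos] with α hα
  rw [slope_def_field, sub_zero, sub_zero, one_smul, zero_smul, add_zero]
  refine div_nonneg (sub_nonneg.2 ?_) hα.1.le
  refine h.2.2 _ ?_ (h.2.1.segment (isDesign_single x) hα.1.le hα.2)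
  refine Finsupp.support_add.trans (Finset.union_subset
    (Finsupp.support_smul.trans h.1) (Finsupp.support_smul.trans ?_))
  exact Finsupp.support_single_subset.trans (Finset.singleton_subset_iff.2 hx)

/-! ### Termination of the sequential algorithm -/

theorem IsSequentialRun.hasOptimalWeights {c : OptCriterion} {M : ι → ModelSpec E Ω}
    {ξopt : ι → Ω →₀ ℝ} {C : Finset Ω} {X : ℕ → Finset Ω} {ξ : ℕ → Ω →₀ ℝ}
    (h : IsSequentialRun c M ξopt C X ξ) : ∀ r, HasOptimalWeights c M ξopt (X r) (ξ r)
  | 0 => h.1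
  | r + 1 => (h.2 r).2

/-- The point sets of a run are eventually constant because the pool is finite. -/
theorem IsSequentialRun.exists_eventually_const {c : OptCriterion} {M : ι → ModelSpec E Ω}
    {ξopt : ι → Ω →₀ ℝ} {C : Finset Ω} {X : ℕ → Finset Ω} {ξ : ℕ → Ω →₀ ℝ}
    (h : IsSequentialRun c M ξopt C X ξ) : ∃ R, ∀ r, R ≤ r → X (r + 1) = X r := by
  classical
  have hmono : Monotone X := monotone_nat_of_le_succ fun r => by
    obtain ⟨x, -, -, hx⟩ := (h.2 r).1
    rw [← Finset.coe_subset, hx]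
    exact Set.subset_insert _ _
  have hsub : ∀ r, X r ⊆ X 0 ∪ C := by
    intro r
    induction r with
    | zero => exact Finset.subset_union_left
    | succ r ih =>
      obtain ⟨x, hxC, -, hx⟩ := (h.2 r).1
      rw [← Finset.coe_insert, Finset.coe_inj] at hx
      rw [hx]
      exact Finset.insert_subset (Finset.mem_union_right _ hxC) ih
  have hfin : (Set.range X).Finite :=
    (Finset.finite_toSet (X 0 ∪ C).powerset).subset (by
      rintro _ ⟨r, rfl⟩
      exact Finset.mem_coe.2 (Finset.mem_powerset.2 (hsub r)))
  obtain ⟨_, ⟨R, rfl⟩, hR⟩ := hfin.exists_maximal (Set.range_nonempty X)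
  have hconst : ∀ r, R ≤ r → X r = X R := fun r hr =>
    le_antisymm (hR ⟨r, rfl⟩ (hmono hr)) (hmono hr)
  exact ⟨R, fun r hr => (hconst _ (hr.trans r.le_succ)).trans (hconst r hr).symm⟩

end Designs

theorem theorem3 {E : ExpFamily} {Ω : Type*} {ι : Type*} [Fintype ι]
    (c : OptCriterion) (M : ι → ModelSpec E Ω)
    (ξopt : ι → Ω →₀ ℝ) (hopt : ∀ j, IsLocalOptimal c (M j) (ξopt j))
    (hpos : ∀ j, 0 < Phi c (M j) (ξopt j))
    (ξmr : Ω →₀ ℝ) (hmr : IsMmDesign c M ξopt ξmr)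
    (C : Finset Ω) (hC : ξmr.support ⊆ C)
    (X : ℕ → Finset Ω) (ξ : ℕ → Ω →₀ ℝ) (hrun : IsSequentialRun c M ξopt C X ξ) :
    Tendsto (fun r => lse c M ξopt (ξ r)) atTop (𝓝 (lse c M ξopt ξmr)) := by
  obtain ⟨R, hR⟩ := hrun.exists_eventually_const
  -- The values are eventually equal to the limit.
  refine tendsto_const_nhds.congr' ?_
  filter_upwards [eventually_ge_atTop R] with r hr
  have hw := hrun.hasOptimalWeights r
  obtain ⟨x, -, hmin, hins⟩ := (hrun.2 r).1
  have hx : x ∈ X r := by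
    rw [← hR r hr, ← Finset.mem_coe, hins]
    exact Set.mem_insert _ _
  have hle : se c M ξopt (ξ r) ≤ se c M ξopt ξmr :=
    se_le_of_dirDerivAt_nonneg hopt hpos hw.2.1 hmr.1 hC fun y hy =>
      (hw.dirDerivAt_nonneg hopt hpos hx).trans (hmin y hy)
  refine le_antisymm (hmr.2 _ hw.2.1) ?_
  -- Without models `se` is the empty sum `0`, so monotonicity of the logarithm on positive reals
  -- does not apply.
  rcases isEmpty_or_nonempty ι with hι | hι
  · simp [lse, se]
  · exact Real.log_le_log (Finset.sum_pos (fun j _ => Real.exp_pos _) Finset.univ_nonempty) hle
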